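/- Consider deterministic Turing machines with one one-way infinite tape, tape alphabet $\{0,1\}$ (where $0$ is also the blank), finite state set $Q$, initial state $q_0$ and halting state $q_h\neq q_0$; each instruction has the form $q\,a\,p\,b\,d$ with $q,p\in Q$, $a,b\in\{0,1\}$ and $d\in\{-1,0,1\}$ (in state $q$ reading $a$, write $b$, go to state $p$, move the head by $d$), there is exactly one instruction for each pair $(q,a)$ with $q\ne q_h$, and a left move on the first cell leaves the head there. Such a machine halts on $w\in\{0,1\}^*$ if, started in state $q_0$ on the first cell with $w$ written on the first $|w|$ cells and $0$ elsewhere, it reaches $q_h$ after finitely many steps. It is universal if it can run every program, i.e. there is a computable function $(e,n)\mapsto w_{e,n}\in\{0,1\}^*$ such that for all $e,n\in\mathbb N$ the machine halts on $w_{e,n}$ if and only if the $e$-th partial recursive function is defined at $n$. Let $M$ be a universal Turing machine with state set $Q$, and let $\tau_M$ be the relational vocabulary \[ \tau_M=\{<,\,U_{\min},\,U_{\max},\,S\}\cup\{H_q,\,H_q^{\mathrm{comp}} : q\in Q\}\cup\{C_0,\,C_0^{\mathrm{comp}}\}, \] where $U_{\min}$ and $U_{\max}$ are unary and all other symbols are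 binary. A first-order formula is universal if it is built up from atomic and negated atomic formulas by means of $\wedge$, $\vee$ and $\forall$. Two sentences are finitely equivalent if they have the same finite (nonempty) models. Then there is no algorithm that, applied to any $\mathrm{FO}[\tau_M]$-sentence $\varphi$ which is finitely equivalent to a universal $\mathrm{FO}[\tau_M]$-sentence, computes such a universal sentence. That is, there is no partial recursive function which, for every $\mathrm{FO}[\tau_M]$-sentence $\varphi$ that is finitely equivalent to some universal $\mathrm{FO}[\tau_M]$-sentence, is defined at the Gödel number of $\varphi$ and whose value there is the Gödel number of a universal $\mathrm{FO}[\tau_M]$-sentence finitely equivalent to $\varphi$. (On all other inputs the function may take any value or be undefined.) -/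

import Mathlib

namespace FinUniv

open scoped FirstOrder

/-- A deterministic Turing machine with one one-way infinite tape (cells numbered by `ℕ`) and tape
alphabet `{0, 1}`, where `false` stands for `0` (also the blank) and `true` for `1`. If
`instr q a = (p, b, d)`, the machine has the instruction `q a p b d`: in state `q` reading `a`,
write `b`, go to state `p` and move the head by `d ∈ {-1, 0, 1}`. The values `instr halt a` are
irrelevant, since a machine in state `halt` has halted. -/
structure Machine where
  numStates : ℕ
  start : Fin numStates
  halt : Fin numStates
  start_ne_halt : start ≠ halt
  instr : Fin numStates → Bool → Fin numStates × Bool × SignType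

/-- Configurations: current state, head position and tape content. -/
structure Machine.Cfg (M : Machine) where
  state : Fin M.numStates
  head : ℕ
  tape : ℕ → Bool

/-- The initial configuration on input `w`: the first `|w|` cells hold `w`, all other cells hold
`0`, and the head scans the first cell. -/
def Machine.init (M : Machine) (w : List Bool) : M.Cfg where
  state := M.start
  head := 0
  tape := fun i => w.getD i false

/-- One computation step; a halted machine stays put. A left move from the first cell leaves the
head on the first cell. -/
def Machine.step (M : Machine) (c : M.Cfg) : M.Cfg :=
  if c.state = M.halt then c
  else
    let r := M.instr c.state (c.tape c.head)
    { state := r.1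
      head := ((c.head : ℤ) + (r.2.2 : ℤ)).toNat
      tape := Function.update c.tape c.head r.2.1 }

/-- `M` eventually reaches its halting state on input `w`. -/
def Machine.HaltsOn (M : Machine) (w : List Bool) : Prop :=
  ∃ k : ℕ, (M.step^[k] (M.init w)).state = M.halt

/-- `M` is universal: the computation of any program `c` (for a partial recursive function) on any
`n` can be run on `M`, by computing a word from `c` and `n` and starting `M` on it. Only agreement
of halting is demanded; this is implied by agreement of halting and of results. -/
def Machine.IsUniversal (M : Machine) : Prop :=
  ∃ word : Nat.Partrec.Code → ℕ → List Bool, Computable₂ word ∧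
    ∀ (c : Nat.Partrec.Code) (n : ℕ), M.HaltsOn (word c n) ↔ (c.eval n).Dom

/-- The relation symbols of the vocabulary of a machine with state set `Q`, by arity:
`<`, `U_min`, `U_max`, `S`, the symbols `H_q` with their complement symbols, and `C_0` with its
complement symbol. -/
inductive MachineRel (Q : Type) : ℕ → Type
  | lt : MachineRel Q 2
  | umin : MachineRel Q 1
  | umax : MachineRel Q 1
  | succ : MachineRel Q 2
  | h (q : Q) : MachineRel Q 2
  | hComp (q : Q) : MachineRel Q 2
  | c0 : MachineRel Q 2
  | c0Comp : MachineRel Q 2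

/-- The relational vocabulary `τ_M`. -/
def Machine.voc (M : Machine) : FirstOrder.Language.{0, 0} :=
  ⟨fun _ => Empty, MachineRel (Fin M.numStates)⟩

/-- Universal formulas: built up from atomic and negated atomic formulas by means of `∧`, `∨`
and `∀`. -/
inductive IsUniv {L : FirstOrder.Language.{0, 0}} {α : Type} : ∀ {n : ℕ}, L.BoundedFormula α n → Prop
  | atomic {n : ℕ} {φ : L.BoundedFormula α n} (hφ : φ.IsAtomic) : IsUniv φ
  | negAtomic {n : ℕ} {φ : L.BoundedFormula α n} (hφ : φ.IsAtomic) : IsUniv φ.not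
  | and {n : ℕ} {φ ψ : L.BoundedFormula α n} (hφ : IsUniv φ) (hψ : IsUniv ψ) : IsUniv (φ ⊓ ψ)
  | or {n : ℕ} {φ ψ : L.BoundedFormula α n} (hφ : IsUniv φ) (hψ : IsUniv ψ) : IsUniv (φ ⊔ ψ)
  | all {n : ℕ} {φ : L.BoundedFormula α (n + 1)} (hφ : IsUniv φ) : IsUniv φ.all

/-- Two sentences are finitely equivalent if they have the same finite (nonempty) models. -/
def FinEquiv {L : FirstOrder.Language.{0, 0}} (φ ψ : L.Sentence) : Prop :=
  ∀ (A : Type) [L.Structure A] [Finite A] [Nonempty A], A ⊨ φ ↔ A ⊨ ψ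

/-- Code numbers of the relation symbols. -/
def relCode {m : ℕ} : ∀ {k : ℕ}, MachineRel (Fin m) k → ℕ
  | _, .lt => 0
  | _, .umin => 1
  | _, .umax => 2
  | _, .succ => 3
  | _, .c0 => 4
  | _, .c0Comp => 5
  | _, .h q => 6 + 2 * q
  | _, .hComp q => 7 + 2 * q

/-- Code numbers of the terms; the vocabulary is relational, so they are all variables. -/
def termCode {M : Machine} {n : ℕ} : M.voc.Term (Empty ⊕ Fin n) → ℕ
  | .var (.inl e) => e.elim
  | .var (.inr i) => i
  | .func f _ => Empty.elim f

/-- Gödel numbers of the formulas without free variables other than `x_0, …, x_{n-1}`. -/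
def godel {M : Machine} : ∀ {n : ℕ}, M.voc.BoundedFormula Empty n → ℕ
  | _, .falsum => Nat.pair 0 0
  | _, .equal t₁ t₂ => Nat.pair 1 (Nat.pair (termCode t₁) (termCode t₂))
  | _, .rel R ts =>
      Nat.pair 2 (Nat.pair (relCode R) (Encodable.encode (List.ofFn fun i => termCode (ts i))))
  | _, .imp φ ψ => Nat.pair 3 (Nat.pair (godel φ) (godel ψ))
  | _, .all φ => Nat.pair 4 (godel φ)

theorem relCode_injective {m k : ℕ} :
    Function.Injective (relCode : MachineRel (Fin m) k → ℕ) := by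
  intro R S h
  cases R <;> cases S <;> simp only [relCode] at h <;> first
    | rfl
    | (exfalso; omega)
    | (congr 1; apply Fin.ext; omega)

theorem relCode_arity {m k l : ℕ} (R : MachineRel (Fin m) k) (S : MachineRel (Fin m) l)
    (h : relCode R = relCode S) : k = l := by
  cases R <;> cases S <;> simp only [relCode] at h <;> first
    | rfl
    | (exfalso; omega)

theorem termCode_injective {M : Machine} {n : ℕ} :
    Function.Injective (termCode : M.voc.Term (Empty ⊕ Fin n) → ℕ) := by
  intro t s h
  match t, s with
  | .var (.inl e), _ => exact e.elim
  | .func f _, _ => exact Empty.elim f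
  | .var (.inr _), .var (.inl e) => exact e.elim
  | .var (.inr _), .func f _ => exact Empty.elim f
  | .var (.inr i), .var (.inr j) => rw [Fin.ext (show (i : ℕ) = j from h)]

/-- Distinct sentences have distinct Gödel numbers. -/
theorem godel_injective {M : Machine} {n : ℕ} :
    Function.Injective (godel : M.voc.BoundedFormula Empty n → ℕ) := by
  intro φ
  induction φ with
  | falsum =>
    intro ψ h
    cases ψ <;> simp [godel, Nat.pair_eq_pair] at h ⊢
  | equal t₁ t₂ =>
    intro ψ h
    cases ψ <;> simp only [godel, Nat.pair_eq_pair] at h <;> first | omega | skip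
    rw [termCode_injective h.2.1, termCode_injective h.2.2]
  | rel R ts =>
    intro ψ h
    cases ψ <;> simp only [godel, Nat.pair_eq_pair] at h <;> first | omega | skip
    obtain ⟨-, hR, ht⟩ := h
    obtain rfl := relCode_arity R _ hR
    rw [relCode_injective hR]
    congr 1
    funext i
    exact termCode_injective (congrFun (List.ofFn_injective (Encodable.encode_injective ht)) i)
  | imp φ₁ φ₂ ih₁ ih₂ =>
    intro ψ h
    cases ψ <;> simp only [godel, Nat.pair_eq_pair] at h <;> first | omega | skip
    rw [ih₁ h.2.1, ih₂ h.2.2]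
  | all φ ih =>
    intro ψ h
    cases ψ <;> simp only [godel, Nat.pair_eq_pair] at h <;> first | omega | skip
    rw [ih h.2]

/-- `f` computes, from every sentence `φ` over `τ_M` that is finitely equivalent to a universal
sentence, such a universal sentence (all sentences being given by their Gödel numbers). On other
inputs the behaviour of `f` is arbitrary; in particular it may diverge. -/
def ComputesUniv (M : Machine) (f : ℕ →. ℕ) : Prop :=
  ∀ φ : M.voc.Sentence, (∃ μ : M.voc.Sentence, IsUniv μ ∧ FinEquiv φ μ) →
    ∃ μ : M.voc.Sentence, IsUniv μ ∧ FinEquiv φ μ ∧ godel μ ∈ f (godel φ)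

end FinUniv

/-!
For a word `w`, the sentence `haltingSentence M w` says that the structure satisfies the universal
order conditions `IsFragment` but does not describe a complete halting computation of `M` on `w`
(`IsHaltingRun`), a computation being described by its space-time diagram, with the elements of
the structure serving both as times and as cells.

Whatever `w` is, this sentence is finitely equivalent to a universal one
(`exists_isUniv_finEquiv_haltingSentence`). A complete substructure of a finite fragment is the
whole fragment (`surjective_of_isComplete`), since it contains the least element and is closed under
immediate successors; hence passing to a substructure never creates a halting run, and the sentence
is preserved under substructures. As a halting run has one element more than the computation has
steps (`IsHaltingRun.exists_haltsAt`), a structure violating the sentence has a violating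
substructure of bounded size, and forbidding these is universal (`exists_isUniv_finEquiv`).

If `M` halts on `w` after `h` steps, the halting run with `h + 1` elements violates the sentence,
but its proper substructures do not. A universal sentence `μ` that fails in a structure fails in
every substructure containing certain elements whose number is at most the number of quantifiers
of `μ`, hence at most its Gödel number (`exists_small_witness`). So `h` is at most the Gödel number
of any universal `μ` finitely equivalent to the sentence (`halts_of_isUniv_finEquiv`).

The Gödel number of `haltingSentence M w` is primitive recursive in `w`. An algorithm computing
equivalent universal sentences would therefore provide a computable bound on halting times, and by
simulating `M` up to this bound one would solve the halting problem for a universal `M`.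
-/

namespace FinUniv

open FirstOrder FirstOrder.Language FirstOrder.Language.BoundedFormula FirstOrder.Language.Structure

section Generic

variable {L : FirstOrder.Language.{0, 0}}

/-! ### Substructures of relational structures -/

/-- In a relational language every subset carries a substructure. -/
def subsetStructure [L.IsRelational] {A : Type} [L.Structure A] (s : Set A) : L.Substructure A where
  carrier := s
  fun_mem := fun f => isEmptyElim f

/-! ### Relativization to a tuple -/

/-- Conjunction (`b = true`) or disjunction (`b = false`) of a list of formulas in `N + 1`
variables; the empty one is the literal `x₀ = x₀`, respectively `x₀ ≠ x₀`. -/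
def junction {N : ℕ} (b : Bool) (l : List (L.BoundedFormula Empty (N + 1))) :
    L.BoundedFormula Empty (N + 1) :=
  match b with
  | true => l.foldr (· ⊓ ·) (((&0 : L.Term (Empty ⊕ Fin (N + 1)))).bdEqual (&0))
  | false => l.foldr (· ⊔ ·) (((&0 : L.Term (Empty ⊕ Fin (N + 1)))).bdEqual (&0)).not

theorem isUniv_junction {N : ℕ} (b : Bool) (l : List (L.BoundedFormula Empty (N + 1)))
    (h : ∀ φ ∈ l, IsUniv φ) : IsUniv (junction b l) := by
  induction l with
  | nil =>
    cases b
    · exact .negAtomic (.equal _ _)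
    · exact .atomic (.equal _ _)
  | cons φ l ih =>
    have h₁ := h φ (by simp)
    have h₂ := ih fun ψ hψ => h ψ (by simp [hψ])
    cases b
    · exact .or h₁ h₂
    · exact .and h₁ h₂

theorem realize_junction_true {N : ℕ} (l : List (L.BoundedFormula Empty (N + 1)))
    {A : Type} [L.Structure A] (v : Empty → A) (x : Fin (N + 1) → A) :
    (junction true l).Realize v x ↔ ∀ φ ∈ l, φ.Realize v x := by
  induction l with
  | nil => simp [junction]
  | cons φ l ih =>
    have : (junction true (φ :: l)) = φ ⊓ junction true l := rfl
    rw [this, realize_inf, ih]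
    simp

theorem realize_junction_false {N : ℕ} (l : List (L.BoundedFormula Empty (N + 1)))
    {A : Type} [L.Structure A] (v : Empty → A) (x : Fin (N + 1) → A) :
    (junction false l).Realize v x ↔ ∃ φ ∈ l, φ.Realize v x := by
  induction l with
  | nil => simp [junction]
  | cons φ l ih =>
    have : (junction false (φ :: l)) = φ ⊔ junction false l := rfl
    rw [this, realize_sup, ih]
    simp

/-- A quantifier-free formula in negation normal form which says about `x₀, …, x_N` that the
formula, or its negation if `b = false`, holds in the substructure `{x₀, …, x_N}`, the
`i`-th variable of the formula taking the value `x_{v i}`. -/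
def relativize {N : ℕ} : Bool → ∀ {n : ℕ}, L.BoundedFormula Empty n → (Fin n → Fin (N + 1)) →
    L.BoundedFormula Empty (N + 1)
  | true, _, .falsum, _ => junction false []
  | false, _, .falsum, _ => junction true []
  | true, _, .equal t₁ t₂, v => .equal (t₁.relabel (Sum.map id v)) (t₂.relabel (Sum.map id v))
  | false, _, .equal t₁ t₂, v =>
      (BoundedFormula.equal (t₁.relabel (Sum.map id v)) (t₂.relabel (Sum.map id v))).not
  | true, _, .rel R ts, v => .rel R fun i => (ts i).relabel (Sum.map id v)
  | false, _, .rel R ts, v => (BoundedFormula.rel R fun i => (ts i).relabel (Sum.map id v)).not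
  | true, _, .imp φ ψ, v => relativize false φ v ⊔ relativize true ψ v
  | false, _, .imp φ ψ, v => relativize true φ v ⊓ relativize false ψ v
  | b, _, .all φ, v =>
      junction b ((List.finRange (N + 1)).map fun i => relativize b φ (Fin.snoc v i))

theorem isUniv_relativize {N n : ℕ} (φ : L.BoundedFormula Empty n) :
    ∀ (b : Bool) (v : Fin n → Fin (N + 1)), IsUniv (relativize b φ v) := by
  induction φ with
  | falsum => intro b v; cases b <;> exact isUniv_junction _ _ (by simp)
  | equal t₁ t₂ =>
    intro b v
    cases b
    · exact .negAtomic (.equal _ _)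
    · exact .atomic (.equal _ _)
  | rel R ts =>
    intro b v
    cases b
    · exact .negAtomic (.rel _ _)
    · exact .atomic (.rel _ _)
  | imp φ ψ ih₁ ih₂ =>
    intro b v
    cases b
    · exact .and (ih₁ _ _) (ih₂ _ _)
    · exact .or (ih₁ _ _) (ih₂ _ _)
  | all φ ih =>
    intro b v
    have : IsUniv (junction b ((List.finRange (N + 1)).map fun i =>
        relativize b φ (Fin.snoc v i))) := by
      refine isUniv_junction _ _ ?_
      simp only [List.mem_map, List.mem_finRange, true_and, forall_exists_index]
      rintro ψ i rfl
      exact ih _ _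
    cases b <;> exact this

theorem realize_relabel_tuple {A B : Type} [L.Structure A] [L.Structure B] (ι : B ↪[L] A)
    {N n : ℕ} (y : Fin (N + 1) → B) (w : Empty → B) (v : Fin n → Fin (N + 1))
    (t : L.Term (Empty ⊕ Fin n)) :
    (t.relabel (Sum.map id v)).realize (Sum.elim (ι ∘ w) (ι ∘ y)) =
      ι (t.realize (Sum.elim w (y ∘ v))) := by
  rw [Term.realize_relabel, ← HomClass.realize_term]
  congr 1
  funext i
  rcases i with i | i
  · exact i.elim
  · rfl

theorem realize_relativize {A B : Type} [L.Structure A] [L.Structure B] (ι : B ↪[L] A)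
    {N n : ℕ} (y : Fin (N + 1) → B) (hy : Function.Surjective y) (w : Empty → B)
    (φ : L.BoundedFormula Empty n) :
    ∀ v : Fin n → Fin (N + 1),
      ((relativize true φ v).Realize (ι ∘ w) (ι ∘ y) ↔ φ.Realize w (y ∘ v)) ∧
      ((relativize false φ v).Realize (ι ∘ w) (ι ∘ y) ↔ ¬ φ.Realize w (y ∘ v)) := by
  induction φ with
  | falsum =>
    intro v
    constructor
    · rw [relativize, realize_junction_false]; simp [BoundedFormula.Realize]
    · rw [relativize, realize_junction_true]; simp [BoundedFormula.Realize]
  | equal t₁ t₂ =>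
    intro v
    simp only [relativize, realize_not, BoundedFormula.Realize, realize_relabel_tuple,
      ι.injective.eq_iff, and_self]
  | rel R ts =>
    intro v
    have : (fun i => ι ((ts i).realize (Sum.elim w (y ∘ v)))) =
      ι ∘ fun i => (ts i).realize (Sum.elim w (y ∘ v)) := rfl
    simp only [relativize, realize_not, BoundedFormula.Realize, realize_relabel_tuple, this,
      ι.map_rel, and_self]
  | imp φ ψ ih₁ ih₂ =>
    intro v
    simp only [relativize, realize_sup, realize_inf, realize_imp, ih₁, ih₂]
    tauto
  | all φ ih =>
    intro v
    have key (i : Fin (N + 1)) :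
        y ∘ (Fin.snoc v i : Fin _ → Fin (N + 1)) = Fin.snoc (y ∘ v) (y i) := by
      rw [Fin.comp_snoc]
    constructor
    · rw [relativize, realize_junction_true, realize_all, hy.forall]
      simp only [List.mem_map, List.mem_finRange, true_and, forall_exists_index,
        forall_apply_eq_imp_iff, ih, key]
    · rw [relativize, realize_junction_false, realize_all, hy.forall, not_forall]
      simp only [List.mem_map, List.mem_finRange, true_and, exists_exists_eq_and, ih, key]

theorem isUniv_alls {n : ℕ} (φ : L.BoundedFormula Empty n) (h : IsUniv φ) :
    IsUniv (φ.alls : L.Sentence) := by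
  induction n with
  | zero => exact h
  | succ n ih => exact ih φ.all (.all h)

/-- A finitary Łoś–Tarski criterion: a sentence that is preserved under substructures of finite
structures, and whose failure in a finite structure is seen in a substructure with at most `N + 1`
elements, is finitely equivalent to a universal one. -/
theorem exists_isUniv_finEquiv [L.IsRelational] (φ : L.Sentence) (N : ℕ)
    (hsub : ∀ (A B : Type) [L.Structure A] [L.Structure B] [Finite A] [Nonempty B],
      (B ↪[L] A) → A ⊨ φ → B ⊨ φ)
    (hsmall : ∀ (A : Type) [L.Structure A] [Finite A] [Nonempty A], ¬ A ⊨ φ →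
      ∃ x : Fin (N + 1) → A, ¬ subsetStructure (L := L) (Set.range x) ⊨ φ) :
    ∃ μ : L.Sentence, IsUniv μ ∧ FinEquiv φ μ := by
  refine ⟨(relativize true φ (Fin.elim0 : Fin 0 → Fin (N + 1))).alls,
    isUniv_alls _ (isUniv_relativize _ _ _), ?_⟩
  intro A _ _ _
  have key (x : Fin (N + 1) → A) :
      (relativize true φ (Fin.elim0 : Fin 0 → Fin (N + 1))).Realize default x ↔
        subsetStructure (L := L) (Set.range x) ⊨ φ := by
    let y : Fin (N + 1) → subsetStructure (L := L) (Set.range x) := fun i => ⟨x i, i, rfl⟩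
    have hy : Function.Surjective y := by
      rintro ⟨_, i, rfl⟩
      exact ⟨i, rfl⟩
    have := (realize_relativize (subsetStructure (L := L) (Set.range x)).subtype y hy default φ
      Fin.elim0).1
    rw [Sentence.Realize, Formula.Realize,
      Subsingleton.elim (default : Fin 0 → _) (y ∘ Fin.elim0),
      Subsingleton.elim (default : Empty → A) ((subsetStructure (L := L) (Set.range x)).subtype ∘
        default)]
    exact this
  have key' : A ⊨ (relativize true φ (Fin.elim0 : Fin 0 → Fin (N + 1))).alls ↔
      ∀ x : Fin (N + 1) → A, subsetStructure (L := L) (Set.range x) ⊨ φ := by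
    rw [Sentence.Realize, realize_alls]
    exact forall_congr' key
  rw [key']
  constructor
  · intro h x
    have : Nonempty (subsetStructure (L := L) (Set.range x)) := ⟨⟨x 0, 0, rfl⟩⟩
    exact hsub A _ (subsetStructure (L := L) (Set.range x)).subtype h
  · intro h
    by_contra hA
    obtain ⟨x, hx⟩ := hsmall A hA
    exact hx (h x)

end Generic

/-! ### Small witnesses for the failure of universal formulas -/

/-- The elements of `s` are the values of the universally quantified variables in a falsification
of `μ`; there are at most as many of them as quantifiers in `μ`. -/
theorem exists_small_witness {M : Machine} {n : ℕ} {μ : M.voc.BoundedFormula Empty n}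
    (hμ : IsUniv μ) {A : Type} [M.voc.Structure A] :
    ∀ x : Fin n → A, ¬ μ.Realize default x →
      ∃ s : Finset A, s.card ≤ godel μ ∧ ∀ (B : Type) [M.voc.Structure B] (ι : B ↪[M.voc] A)
        (y : Fin n → B), ι ∘ y = x → (∀ a ∈ s, a ∈ Set.range ι) → ¬ μ.Realize default y := by
  classical
  have qf {n : ℕ} {φ : M.voc.BoundedFormula Empty n} (hφ : φ.IsQF) (x : Fin n → A)
      (h : ¬ φ.Realize default x) :
      ∃ s : Finset A, s.card ≤ godel φ ∧ ∀ (B : Type) [M.voc.Structure B] (ι : B ↪[M.voc] A)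
        (y : Fin n → B), ι ∘ y = x → (∀ a ∈ s, a ∈ Set.range ι) → ¬ φ.Realize default y := by
    refine ⟨∅, by simp, ?_⟩
    rintro B _ ι y rfl - hy
    rw [← hφ.realize_embedding ι] at hy
    exact h (by convert hy)
  induction hμ with
  | atomic hφ => exact qf hφ.isQF
  | negAtomic hφ => exact qf hφ.isQF.not
  | @and n φ ψ hφ hψ ih₁ ih₂ =>
    intro x h
    have hc : godel φ + godel ψ ≤ godel (φ ⊓ ψ) := by
      have h₁ := Nat.add_le_pair 3 (Nat.pair (godel (φ.imp ψ.not)) (Nat.pair 0 0))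
      have h₂ := Nat.add_le_pair (godel (φ.imp ψ.not)) (Nat.pair 0 0)
      have h₃ := Nat.add_le_pair 3 (Nat.pair (godel φ) (godel ψ.not))
      have h₄ := Nat.add_le_pair (godel φ) (godel ψ.not)
      have h₅ := Nat.add_le_pair 3 (Nat.pair (godel ψ) (Nat.pair 0 0))
      have h₆ := Nat.add_le_pair (godel ψ) (Nat.pair 0 0)
      have e₁ : godel (φ ⊓ ψ) = Nat.pair 3 (Nat.pair (godel (φ.imp ψ.not)) (Nat.pair 0 0)) := rfl
      have e₂ : godel (φ.imp ψ.not) = Nat.pair 3 (Nat.pair (godel φ) (godel ψ.not)) := rfl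
      have e₃ : godel ψ.not = Nat.pair 3 (Nat.pair (godel ψ) (Nat.pair 0 0)) := rfl
      omega
    rw [realize_inf, not_and_or] at h
    rcases h with h | h
    · obtain ⟨s, hs, H⟩ := ih₁ x h
      exact ⟨s, by omega, fun B _ ι y hy hB hr => H B ι y hy hB (realize_inf.1 hr).1⟩
    · obtain ⟨s, hs, H⟩ := ih₂ x h
      exact ⟨s, by omega, fun B _ ι y hy hB hr => H B ι y hy hB (realize_inf.1 hr).2⟩
  | @or n φ ψ hφ hψ ih₁ ih₂ =>
    intro x h
    have hc : godel φ + godel ψ ≤ godel (φ ⊔ ψ) := by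
      have h₁ := Nat.add_le_pair 3 (Nat.pair (godel φ.not) (godel ψ))
      have h₂ := Nat.add_le_pair (godel φ.not) (godel ψ)
      have h₃ := Nat.add_le_pair 3 (Nat.pair (godel φ) (Nat.pair 0 0))
      have h₄ := Nat.add_le_pair (godel φ) (Nat.pair 0 0)
      have e₁ : godel (φ ⊔ ψ) = Nat.pair 3 (Nat.pair (godel φ.not) (godel ψ)) := rfl
      have e₂ : godel φ.not = Nat.pair 3 (Nat.pair (godel φ) (Nat.pair 0 0)) := rfl
      omega
    rw [realize_sup, not_or] at h
    obtain ⟨s, hs, H⟩ := ih₁ x h.1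
    obtain ⟨t, ht, K⟩ := ih₂ x h.2
    refine ⟨s ∪ t, (Finset.card_union_le _ _).trans (by omega), fun B _ ι y hy hB hr => ?_⟩
    rcases realize_sup.1 hr with hr | hr
    · exact H B ι y hy (fun a ha => hB a (Finset.mem_union_left _ ha)) hr
    · exact K B ι y hy (fun a ha => hB a (Finset.mem_union_right _ ha)) hr
  | @all n φ hφ ih =>
    intro x h
    rw [realize_all, not_forall] at h
    obtain ⟨a, ha⟩ := h
    obtain ⟨s, hs, H⟩ := ih _ ha
    have hc : godel φ + 1 ≤ godel φ.all := by
      have h₁ := Nat.add_le_pair 4 (godel φ)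
      have e₁ : godel φ.all = Nat.pair 4 (godel φ) := rfl
      omega
    refine ⟨insert a s, (Finset.card_insert_le _ _).trans (by omega), ?_⟩
    rintro B _ ι y rfl hB hr
    obtain ⟨b, rfl⟩ := hB a (Finset.mem_insert_self _ _)
    refine H B ι (Fin.snoc y b) ?_ (fun a ha => hB a (Finset.mem_insert_of_mem ha))
      (realize_all.1 hr b)
    rw [Fin.comp_snoc]

section Sentences

variable {M : Machine}

/-! ### Structures over the vocabulary of a machine -/

instance : M.voc.IsRelational := fun _ => inferInstanceAs (IsEmpty Empty)

/-- Interpretation of the unary symbols. -/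
def holds₁ {A : Type} [M.voc.Structure A] (R : MachineRel (Fin M.numStates) 1) (a : A) : Prop :=
  RelMap (L := M.voc) R ![a]

/-- Interpretation of the binary symbols. -/
def holds₂ {A : Type} [M.voc.Structure A] (R : MachineRel (Fin M.numStates) 2) (a b : A) : Prop :=
  RelMap (L := M.voc) R ![a, b]

theorem holds₁_map {A B : Type} [M.voc.Structure A] [M.voc.Structure B] (ι : B ↪[M.voc] A)
    (R : MachineRel (Fin M.numStates) 1) (a : B) : holds₁ R (ι a) ↔ holds₁ R a := by
  have h : ![ι a] = ι ∘ ![a] := by funext i; fin_cases i; rfl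
  have key : RelMap (L := M.voc) R (ι ∘ ![a]) ↔ RelMap (L := M.voc) R ![a] := ι.map_rel R _
  rwa [← h] at key

theorem holds₂_map {A B : Type} [M.voc.Structure A] [M.voc.Structure B] (ι : B ↪[M.voc] A)
    (R : MachineRel (Fin M.numStates) 2) (a b : B) :
    holds₂ R (ι a) (ι b) ↔ holds₂ R a b := by
  have h : ![ι a, ι b] = ι ∘ ![a, b] := by funext i; fin_cases i <;> rfl
  have key : RelMap (L := M.voc) R (ι ∘ ![a, b]) ↔ RelMap (L := M.voc) R ![a, b] := ι.map_rel R _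
  rwa [← h] at key

/-- Cell `a` holds the symbol `b` at time `t`. -/
def bitIs {A : Type} [M.voc.Structure A] : Bool → A → A → Prop
  | false, a, t => holds₂ (M := M) .c0 a t
  | true, a, t => ¬ holds₂ (M := M) .c0 a t

/-- A move in direction `d` leads from cell `a` to cell `b`. -/
def moves {A : Type} [M.voc.Structure A] : SignType → A → A → Prop
  | .zero, a, b => b = a
  | .pos, a, b => holds₂ (M := M) .succ a b
  | .neg, a, b => holds₂ (M := M) .succ b a ∨ (holds₁ (M := M) .umin a ∧ b = a)

/-- The universal conditions on the order symbols: `<` is a strict linear order, elements of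
`U_min` and `U_max` are extremal, and `S` relates elements to immediate successors. They hold in
every substructure of a finite order with its true endpoints and successor relation. -/
structure IsFragment (M : Machine) (A : Type) [M.voc.Structure A] : Prop where
  irrefl (a : A) : ¬ holds₂ (M := M) .lt a a
  trans (a b c : A) : holds₂ (M := M) .lt a b → holds₂ (M := M) .lt b c → holds₂ (M := M) .lt a c
  total (a b : A) : holds₂ (M := M) .lt a b ∨ a = b ∨ holds₂ (M := M) .lt b a
  umin (a b : A) : holds₁ (M := M) .umin a → ¬ holds₂ (M := M) .lt b a
  umax (a b : A) : holds₁ (M := M) .umax a → ¬ holds₂ (M := M) .lt a b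
  lt_of_succ (a b : A) : holds₂ (M := M) .succ a b → holds₂ (M := M) .lt a b
  not_between (a b c : A) : holds₂ (M := M) .succ a b → holds₂ (M := M) .lt a c →
    ¬ holds₂ (M := M) .lt c b

/-- There is an element of `U_min`, and every element outside `U_max` has an `S`-successor. -/
structure IsComplete (M : Machine) (A : Type) [M.voc.Structure A] : Prop where
  exists_umin : ∃ a : A, holds₁ (M := M) .umin a
  exists_succ (a : A) : holds₁ (M := M) .umax a ∨ ∃ b, holds₂ (M := M) .succ a b

/-- `H_q(x, t)` and `C_0(x, t)` describe, for the head on cell `x` in state `q` at time `t` and a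
`0` in cell `x` at time `t`, a computation that halts at the last time and not before. -/
structure IsRun (M : Machine) (A : Type) [M.voc.Structure A] : Prop where
  start (a : A) : holds₁ (M := M) .umin a → holds₂ (M := M) (.h M.start) a a
  halt (a t : A) : holds₂ (M := M) (.h M.halt) a t → holds₁ (M := M) .umax t
  not_halt (q : Fin M.numStates) (hq : q ≠ M.halt) (a t : A) : holds₂ (M := M) (.h q) a t →
    ¬ holds₁ (M := M) .umax t
  step (q : Fin M.numStates) (hq : q ≠ M.halt) (b : Bool) (t t' a : A) :
    holds₂ (M := M) .succ t t' → holds₂ (M := M) (.h q) a t → bitIs (M := M) b a t →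
    bitIs (M := M) (M.instr q b).2.1 a t' ∧
    (∀ y, y = a ∨ (holds₂ (M := M) .c0 y t' ↔ holds₂ (M := M) .c0 y t)) ∧
    ∀ y, moves (M := M) (M.instr q b).2.2 a y → holds₂ (M := M) (.h (M.instr q b).1) y t'

/-- At time `t`, the cells from `a` on hold the word `w`, followed by `0`s. -/
def tapeFrom {A : Type} [M.voc.Structure A] (t : A) : List Bool → A → Prop
  | [], a => ∀ y, holds₂ (M := M) .lt y a ∨ holds₂ (M := M) .c0 y t
  | b :: w, a => bitIs (M := M) b a t ∧ ∀ y, holds₂ (M := M) .succ a y → tapeFrom t w y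

/-- The structure describes a complete halting computation of `M` on `w`. -/
structure IsHaltingRun (M : Machine) (w : List Bool) (A : Type) [M.voc.Structure A] : Prop where
  complete : IsComplete M A
  run : IsRun M A
  tape (a : A) : holds₁ (M := M) .umin a → tapeFrom (M := M) a w a

/-! ### The sentences -/

/-- Unary atomic formulas. -/
def unary {n : ℕ} (R : MachineRel (Fin M.numStates) 1) (i : Fin n) : M.voc.BoundedFormula Empty n :=
  Relations.boundedFormula₁ (L := M.voc) R (&i)

/-- Binary atomic formulas. -/
def binary {n : ℕ} (R : MachineRel (Fin M.numStates) 2) (i j : Fin n) :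
    M.voc.BoundedFormula Empty n :=
  Relations.boundedFormula₂ (L := M.voc) R (&i) (&j)

/-- Equations between variables. -/
def equation {n : ℕ} (i j : Fin n) : M.voc.BoundedFormula Empty n :=
  Term.bdEqual (&i) (&j)

variable {A : Type} [M.voc.Structure A] {n : ℕ} (v : Empty → A) (x : Fin n → A)

@[simp]
theorem realize_unary (R : MachineRel (Fin M.numStates) 1) (i : Fin n) :
    (unary R i).Realize v x ↔ holds₁ R (x i) := by
  exact realize_rel₁ (L := M.voc)

@[simp]
theorem realize_binary (R : MachineRel (Fin M.numStates) 2) (i j : Fin n) :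
    (binary R i j).Realize v x ↔ holds₂ R (x i) (x j) := by
  exact realize_rel₂ (L := M.voc)

@[simp]
theorem realize_equation (i j : Fin n) : (equation (M := M) i j).Realize v x ↔ x i = x j := by
  unfold equation
  rw [realize_bdEqual]
  rfl

/-- The formula for `bitIs`. -/
def bitFormula (b : Bool) (i j : Fin n) : M.voc.BoundedFormula Empty n :=
  match b with
  | false => binary .c0 i j
  | true => (binary .c0 i j).not

@[simp]
theorem realize_bitFormula (b : Bool) (i j : Fin n) :
    (bitFormula (M := M) b i j).Realize v x ↔ bitIs (M := M) b (x i) (x j) := by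
  cases b <;> simp [bitFormula, bitIs]

/-- The formula for `moves`. -/
def moveFormula (d : SignType) (i j : Fin n) : M.voc.BoundedFormula Empty n :=
  match d with
  | .zero => equation j i
  | .pos => binary .succ i j
  | .neg => binary .succ j i ⊔ (unary .umin i ⊓ equation j i)

@[simp]
theorem realize_moveFormula (d : SignType) (i j : Fin n) :
    (moveFormula (M := M) d i j).Realize v x ↔ moves (M := M) d (x i) (x j) := by
  cases d <;> simp [moveFormula, moves]

/-- The sentence for `IsFragment`. -/
def fragmentSentence (M : Machine) : M.voc.Sentence :=
  ((binary .lt 0 0).not.all : M.voc.Sentence) ⊓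
  (((binary .lt 0 1).imp ((binary .lt 1 2).imp (binary .lt 0 2))).all.all.all ⊓
  ((binary .lt 0 1 ⊔ (equation 0 1 ⊔ binary .lt 1 0)).all.all ⊓
  (((unary .umin 0).imp (binary .lt 1 0).not).all.all ⊓
  (((unary .umax 0).imp (binary .lt 0 1).not).all.all ⊓
  (((binary .succ 0 1).imp (binary .lt 0 1)).all.all ⊓
  ((binary .succ 0 1).imp ((binary .lt 0 2).imp (binary .lt 2 1).not)).all.all.all)))))

theorem realize_fragmentSentence (A : Type) [M.voc.Structure A] :
    A ⊨ fragmentSentence M ↔ IsFragment M A := by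
  simp only [Sentence.Realize, Formula.Realize, fragmentSentence, realize_inf, realize_all,
    realize_not, realize_imp, realize_sup, realize_unary, realize_binary, realize_equation]
  exact ⟨fun ⟨h₁, h₂, h₃, h₄, h₅, h₆, h₇⟩ => ⟨h₁, h₂, h₃, h₄, h₅, h₆, h₇⟩,
    fun ⟨h₁, h₂, h₃, h₄, h₅, h₆, h₇⟩ => ⟨h₁, h₂, h₃, h₄, h₅, h₆, h₇⟩⟩

/-- The sentence for `IsComplete`. -/
def completeSentence (M : Machine) : M.voc.Sentence :=
  ((unary .umin 0).ex : M.voc.Sentence) ⊓ (unary .umax 0 ⊔ (binary .succ 0 1).ex).all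

theorem realize_completeSentence (A : Type) [M.voc.Structure A] :
    A ⊨ completeSentence M ↔ IsComplete M A := by
  simp only [Sentence.Realize, Formula.Realize, completeSentence, realize_inf, realize_all,
    realize_ex, realize_sup, realize_unary, realize_binary]
  exact ⟨fun ⟨h₁, h₂⟩ => ⟨h₁, h₂⟩, fun ⟨h₁, h₂⟩ => ⟨h₁, h₂⟩⟩

/-- The sentence for one clause of `IsRun.step`; the variables `0, 1, 2, 3` stand for
`t, t', a, y`. -/
def stepSentence (q : Fin M.numStates) (b : Bool) : M.voc.Sentence :=
  ((binary .succ 0 1).imp ((binary (.h q) 2 0).imp ((bitFormula b 2 0).imp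
    (bitFormula (M.instr q b).2.1 2 1 ⊓
    ((equation 3 2 ⊔ (binary .c0 3 1).iff (binary .c0 3 0)).all ⊓
    ((moveFormula (M.instr q b).2.2 2 3).imp
      (binary (.h (M.instr q b).1) 3 1)).all))))).all.all.all

/-- The sentence for `IsRun`. -/
noncomputable def runSentence (M : Machine) : M.voc.Sentence :=
  ((unary .umin 0).imp (binary (.h M.start) 0 0)).all ⊓
  (((binary (.h M.halt) 0 1).imp (unary .umax 1)).all.all ⊓
  ((BoundedFormula.iInf fun q : {q // q ≠ M.halt} =>
    ((binary (.h q.1) 0 1).imp (unary .umax 1).not).all.all) ⊓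
  (BoundedFormula.iInf fun q : {q // q ≠ M.halt} =>
    BoundedFormula.iInf fun b : Bool => stepSentence q.1 b)))

theorem realize_runSentence (A : Type) [M.voc.Structure A] :
    A ⊨ runSentence M ↔ IsRun M A := by
  simp only [Sentence.Realize, Formula.Realize, runSentence, stepSentence, realize_inf,
    realize_all, realize_not, realize_imp, realize_sup, realize_iff, realize_iInf, realize_unary,
    realize_binary, realize_equation, realize_bitFormula, realize_moveFormula]
  exact ⟨fun ⟨h₁, h₂, h₃, h₄⟩ => ⟨h₁, h₂, fun q hq => h₃ ⟨q, hq⟩, fun q hq => h₄ ⟨q, hq⟩⟩,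
    fun ⟨h₁, h₂, h₃, h₄⟩ => ⟨h₁, h₂, fun q => h₃ q.1 q.2, fun q => h₄ q.1 q.2⟩⟩

/-- The formula for `tapeFrom`, the time being the first variable and the cell the last one. -/
def tapeFormula (M : Machine) : List Bool → ∀ n : ℕ, M.voc.BoundedFormula Empty (n + 1)
  | [], n => (binary .lt (Fin.last (n + 1)) (Fin.last n).castSucc ⊔
      binary .c0 (Fin.last (n + 1)) 0).all
  | b :: w, n => bitFormula b (Fin.last n) 0 ⊓
      ((binary .succ (Fin.last n).castSucc (Fin.last (n + 1))).imp (tapeFormula M w (n + 1))).all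

theorem realize_tapeFormula (w : List Bool) : ∀ {n : ℕ} (x : Fin (n + 1) → A),
    (tapeFormula M w n).Realize v x ↔ tapeFrom (M := M) (x 0) w (x (Fin.last n)) := by
  have zero {n : ℕ} (x : Fin (n + 1) → A) (a : A) :
      (Fin.snoc x a : Fin (n + 2) → A) 0 = x 0 := Fin.snoc_castSucc (α := fun _ => A) a x 0
  induction w with
  | nil =>
    intro n x
    simp only [tapeFormula, tapeFrom, realize_all, realize_sup, realize_binary, Fin.snoc_last,
      Fin.snoc_castSucc, zero]
  | cons b w ih =>
    intro n x
    simp only [tapeFormula, tapeFrom, realize_all, realize_inf, realize_imp, realize_binary,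
      realize_bitFormula, Fin.snoc_last, Fin.snoc_castSucc, ih, zero]

/-- The sentence saying that the structure is a fragment of an order but does not describe a
complete halting computation of `M` on `w`. -/
noncomputable def haltingSentence (M : Machine) (w : List Bool) : M.voc.Sentence :=
  fragmentSentence M ⊓
    (completeSentence M ⊓ (runSentence M ⊓ ((unary .umin 0).imp (tapeFormula M w 0)).all)).not

theorem realize_haltingSentence (w : List Bool) (A : Type) [M.voc.Structure A] :
    A ⊨ haltingSentence M w ↔ IsFragment M A ∧ ¬ IsHaltingRun M w A := by
  have h₁ := realize_fragmentSentence (M := M) A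
  have h₂ := realize_completeSentence (M := M) A
  have h₃ := realize_runSentence (M := M) A
  unfold Sentence.Realize Formula.Realize at *
  simp only [haltingSentence, realize_inf, realize_not, realize_all, realize_imp, realize_unary,
    realize_tapeFormula, h₁, h₂, h₃]
  refine and_congr Iff.rfl (not_congr ?_)
  exact ⟨fun ⟨h₁, h₂, h₃⟩ => ⟨h₁, h₂, h₃⟩, fun ⟨h₁, h₂, h₃⟩ => ⟨h₁, h₂, h₃⟩⟩

end Sentences

/-! ### Complete substructures -/

section Substructures

variable {M : Machine}

theorem IsFragment.of_embedding {A B : Type} [M.voc.Structure A] [M.voc.Structure B]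
    (ι : B ↪[M.voc] A) (h : IsFragment M A) : IsFragment M B where
  irrefl a := by simpa only [holds₂_map] using h.irrefl (ι a)
  trans a b c := by simpa only [holds₂_map] using h.trans (ι a) (ι b) (ι c)
  total a b := by simpa only [holds₂_map, ι.injective.eq_iff] using h.total (ι a) (ι b)
  umin a b := by simpa only [holds₁_map, holds₂_map] using h.umin (ι a) (ι b)
  umax a b := by simpa only [holds₁_map, holds₂_map] using h.umax (ι a) (ι b)
  lt_of_succ a b := by simpa only [holds₂_map] using h.lt_of_succ (ι a) (ι b)
  not_between a b c := by simpa only [holds₂_map] using h.not_between (ι a) (ι b) (ι c)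

/-- The conditions of `IsFragment` involve three elements at a time. -/
theorem isFragment_of_triples {A : Type} [M.voc.Structure A]
    (h : ∀ a b c : A, ∃ s : Set A, a ∈ s ∧ b ∈ s ∧ c ∈ s ∧
      IsFragment M (subsetStructure (L := M.voc) s)) : IsFragment M A := by
  have key (a b c : A) : ∃ (B : Type) (_ : M.voc.Structure B) (ι : B ↪[M.voc] A) (a' b' c' : B),
      IsFragment M B ∧ ι a' = a ∧ ι b' = b ∧ ι c' = c := by
    obtain ⟨s, ha, hb, hc, hs⟩ := h a b c
    exact ⟨_, _, (subsetStructure (L := M.voc) s).subtype, ⟨a, ha⟩, ⟨b, hb⟩, ⟨c, hc⟩, hs,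
      rfl, rfl, rfl⟩
  constructor
  · intro a
    obtain ⟨B, _, ι, a, b, c, hB, rfl, -, -⟩ := key a a a
    simpa only [holds₂_map] using hB.irrefl a
  · intro a b c
    obtain ⟨B, _, ι, a, b, c, hB, rfl, rfl, rfl⟩ := key a b c
    simpa only [holds₂_map] using hB.trans a b c
  · intro a b
    obtain ⟨B, _, ι, a, b, c, hB, rfl, rfl, -⟩ := key a b b
    simpa only [holds₂_map, ι.injective.eq_iff] using hB.total a b
  · intro a b
    obtain ⟨B, _, ι, a, b, c, hB, rfl, rfl, -⟩ := key a b b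
    simpa only [holds₁_map, holds₂_map] using hB.umin a b
  · intro a b
    obtain ⟨B, _, ι, a, b, c, hB, rfl, rfl, -⟩ := key a b b
    simpa only [holds₁_map, holds₂_map] using hB.umax a b
  · intro a b
    obtain ⟨B, _, ι, a, b, c, hB, rfl, rfl, -⟩ := key a b b
    simpa only [holds₂_map] using hB.lt_of_succ a b
  · intro a b c
    obtain ⟨B, _, ι, a, b, c, hB, rfl, rfl, rfl⟩ := key a b c
    simpa only [holds₂_map] using hB.not_between a b c

/-- A fragment has no proper complete substructure: with its minimum, a complete substructure
contains the immediate successor, in the whole structure, of each of its elements. -/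
theorem surjective_of_isComplete {A B : Type} [M.voc.Structure A] [M.voc.Structure B] [Finite A]
    (ι : B ↪[M.voc] A) (hA : IsFragment M A) (hB : IsComplete M B) : Function.Surjective ι := by
  intro a
  by_contra ha
  have hne (b : B) : ι b ≠ a := fun h => ha ⟨b, h⟩
  have : Finite B := Finite.of_injective ι ι.injective
  let r (b c : B) : Prop := holds₂ (M := M) .lt c b
  have : IsTrans B r := ⟨fun b c d h₁ h₂ => (hA.of_embedding ι).trans _ _ _ h₂ h₁⟩
  have : Std.Irrefl r := ⟨fun b => (hA.of_embedding ι).irrefl b⟩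
  obtain ⟨m, hm⟩ := hB.exists_umin
  have hma : holds₂ (M := M) .lt (ι m) a := by
    rcases hA.total (ι m) a with h | h | h
    · exact h
    · exact (hne _ h).elim
    · exact (hA.umin _ _ ((holds₁_map ι _ _).2 hm) h).elim
  -- the largest element of the substructure below `a`
  obtain ⟨b, hb, hmax⟩ := (Finite.wellFounded_of_trans_of_irrefl r).has_min
    {b | holds₂ (M := M) .lt (ι b) a} ⟨m, hma⟩
  rcases hB.exists_succ b with h | ⟨c, h⟩
  · exact hA.umax _ _ ((holds₁_map ι _ _).2 h) hb
  · have hbc := (holds₂_map ι _ _ _).2 h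
    rcases hA.total (ι c) a with h' | h' | h'
    · exact hmax c h' ((holds₂_map ι _ _ _).1 (hA.lt_of_succ _ _ hbc))
    · exact hne _ h'
    · exact hA.not_between _ _ _ hbc hb h'

theorem realize_sentence_of_surjective {L : FirstOrder.Language.{0, 0}} {A B : Type}
    [L.Structure A] [L.Structure B] (ι : B ↪[L] A) (h : Function.Surjective ι) (φ : L.Sentence) :
    B ⊨ φ ↔ A ⊨ φ := by
  let e : B ≃[L] A :=
    { Equiv.ofBijective ι ⟨ι.injective, h⟩ with
      map_fun' := fun f x => ι.map_fun f x
      map_rel' := fun R x => ι.map_rel R x }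
  exact StrongHomClass.realize_sentence e φ

end Substructures

section Runs

variable {M : Machine}

/-! ### Halting runs as finite structures -/

/-- The configuration of `M` after `t` steps on input `w`. -/
def Machine.cfgAt (M : Machine) (w : List Bool) (t : ℕ) : M.Cfg := M.step^[t] (M.init w)

theorem Machine.cfgAt_succ (w : List Bool) (t : ℕ) :
    M.cfgAt w (t + 1) = M.step (M.cfgAt w t) :=
  Function.iterate_succ_apply' _ _ _

theorem toNat_add_sign (k : ℕ) (d : SignType) :
    ((k : ℤ) + (d : ℤ)).toNat = match d with | .zero => k | .neg => k - 1 | .pos => k + 1 := by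
  rcases d with _ | _ | _ <;> simp [SignType.cast]
  omega

theorem Machine.head_cfgAt_le (w : List Bool) (t : ℕ) : (M.cfgAt w t).head ≤ t := by
  induction t with
  | zero => exact le_rfl
  | succ t ih =>
    rw [Machine.cfgAt_succ, Machine.step]
    split_ifs
    · omega
    · dsimp only
      rw [toNat_add_sign]
      split <;> omega

/-- A halted machine stays halted. -/
theorem Machine.state_cfgAt_of_le {w : List Bool} {t t' : ℕ} (h : t ≤ t')
    (ht : (M.cfgAt w t).state = M.halt) : (M.cfgAt w t').state = M.halt := by
  induction h with
  | refl => exact ht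
  | step _ ih => rw [Machine.cfgAt_succ, Machine.step, if_pos ih]; exact ih

/-- `M` reaches its halting state on `w` after exactly `h` steps. -/
def Machine.HaltsAt (M : Machine) (w : List Bool) (h : ℕ) : Prop :=
  (M.cfgAt w h).state = M.halt ∧ ∀ t < h, (M.cfgAt w t).state ≠ M.halt

theorem Machine.HaltsAt.eq {w : List Bool} {h h' : ℕ} (H : M.HaltsAt w h) (H' : M.HaltsAt w h') :
    h = h' := by
  rcases lt_trichotomy h h' with hlt | heq | hlt
  · exact (H'.2 _ hlt H.1).elim
  · exact heq
  · exact (H.2 _ hlt H'.1).elim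

/-- Numbering of a complete fragment: it is a finite order with its true endpoints and successor
relation. -/
theorem IsFragment.exists_numbering {A : Type} [M.voc.Structure A] [Finite A]
    (hA : IsFragment M A) (hC : IsComplete M A) :
    ∃ (k : ℕ) (e : A ≃ Fin (k + 1)), ∀ a b : A,
      (holds₂ (M := M) .lt a b ↔ (e a : ℕ) < e b) ∧
      (holds₁ (M := M) .umin a ↔ (e a : ℕ) = 0) ∧
      (holds₁ (M := M) .umax a ↔ (e a : ℕ) = k) ∧
      (holds₂ (M := M) .succ a b ↔ (e b : ℕ) = e a + 1) := by
  classical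
  have : Fintype A := Fintype.ofFinite A
  obtain ⟨m, hm⟩ := hC.exists_umin
  have : Nonempty A := ⟨m⟩
  have : IsStrictTotalOrder A (fun a b => holds₂ (M := M) .lt a b) :=
    { irrefl := hA.irrefl
      trans := hA.trans
      trichotomous := fun a b h₁ h₂ => by
        rcases hA.total a b with h | h | h
        · exact (h₁ h).elim
        · exact h
        · exact (h₂ h).elim }
  let : LinearOrder A := linearOrderOfSTO (fun a b => holds₂ (M := M) .lt a b)
  obtain ⟨k, hk⟩ : ∃ k, Fintype.card A = k + 1 := ⟨Fintype.card A - 1, by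
    have := Fintype.card_pos (α := A)
    omega⟩
  let e : A ≃o Fin (k + 1) := (Fintype.orderIsoFinOfCardEq A hk).symm
  have hlt (a b : A) : holds₂ (M := M) .lt a b ↔ (e a : ℕ) < e b :=
    (e.lt_iff_lt (x := a) (y := b)).symm
  have heq (a b : A) : (e a : ℕ) = e b → a = b := fun h => e.injective (Fin.ext h)
  have hmin (a : A) (ha : holds₁ (M := M) .umin a) : (e a : ℕ) = 0 := by
    have := hA.umin a (e.symm 0) ha
    rw [hlt, OrderIso.apply_symm_apply] at this
    simpa using this
  have hmax (a : A) (ha : holds₁ (M := M) .umax a) : (e a : ℕ) = k := by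
    have := hA.umax a (e.symm (Fin.last k)) ha
    rw [hlt, OrderIso.apply_symm_apply, Fin.val_last] at this
    have := (e a).isLt
    omega
  have hsucc (a b : A) (h : holds₂ (M := M) .succ a b) : (e b : ℕ) = e a + 1 := by
    have h₁ := (hlt _ _).1 (hA.lt_of_succ a b h)
    have hlt' : (e a : ℕ) + 1 < k + 1 := by have := (e b).isLt; omega
    have h₂ := hA.not_between a b (e.symm ⟨e a + 1, hlt'⟩) h
    rw [hlt, hlt, OrderIso.apply_symm_apply] at h₂
    simp only [lt_add_iff_pos_right, zero_lt_one, not_lt, forall_const] at h₂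
    omega
  refine ⟨k, e.toEquiv, fun a b => ⟨hlt a b, ⟨hmin a, fun h => ?_⟩, ⟨hmax a, fun h => ?_⟩,
    ⟨hsucc a b, fun h => ?_⟩⟩⟩
  · rwa [heq a m (h.trans (hmin m hm).symm)]
  · rcases hC.exists_succ a with h' | ⟨b, hb⟩
    · exact h'
    · have h₁ := hsucc a b hb
      have h₂ := (e b).isLt
      replace h : (e a : ℕ) = k := h
      omega
  · replace h : (e b : ℕ) = e a + 1 := h
    rcases hC.exists_succ a with h' | ⟨c, hc⟩
    · have h₁ := hmax a h'
      have h₂ := (e b).isLt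
      omega
    · rwa [heq b c (h.trans (hsucc a c hc).symm)]

/-- A complete halting run has as many elements as the computation has configurations. -/
theorem IsHaltingRun.exists_haltsAt {w : List Bool} {A : Type} [M.voc.Structure A] [Finite A]
    (hA : IsFragment M A) (h : IsHaltingRun M w A) :
    ∃ k, M.HaltsAt w k ∧ Nat.card A = k + 1 := by
  obtain ⟨k, e, he⟩ := hA.exists_numbering h.complete
  have hlt (a b : A) := (he a b).1
  have hmin (a : A) := (he a a).2.1
  have hmax (a : A) := (he a a).2.2.1
  have hsucc (a b : A) := (he a b).2.2.2
  have hbit (b : Bool) (a t : A) (c : Bool) (hc : holds₂ (M := M) .c0 a t ↔ c = false) :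
      bitIs (M := M) b a t ↔ c = b := by
    cases b <;> simp [bitIs, hc]
  -- the tape at time `0`
  have htape (m : A) : ∀ (w : List Bool) (a : A), tapeFrom (M := M) m w a →
      ∀ y, e a ≤ e y → (holds₂ (M := M) .c0 y m ↔ w.getD (e y - e a : ℕ) false = false) := by
    intro w
    induction w with
    | nil =>
      intro a ha y hy
      rcases ha y with h' | h'
      · rw [hlt] at h'
        exact absurd h' (not_lt.2 hy)
      · simpa using h'
    | cons b w ih =>
      intro a ha y hy
      rcases hy.eq_or_lt with hay | hay
      · obtain rfl := e.injective hay
        have := ha.1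
        cases b <;> simpa [bitIs] using this
      · have hay' : (e a : ℕ) < e y := hay
        have hs := (hsucc a (e.symm ⟨e a + 1, by have := (e y).isLt; omega⟩)).2 (by simp)
        have := ih _ (ha.2 _ hs) y (by rw [Equiv.apply_symm_apply]; exact hay')
        rw [this, Equiv.apply_symm_apply]
        have e₁ : (e y - e a : ℕ) = (e y - (e a + 1) : ℕ) + 1 := by omega
        rw [e₁, List.getD_cons_succ]
  -- the configuration at time `t` is the one described by the structure
  have main : ∀ t ≤ k, ∀ s : A, (e s : ℕ) = t →
      (∀ x, (e x : ℕ) = (M.cfgAt w t).head → holds₂ (M := M) (.h (M.cfgAt w t).state) x s) ∧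
      ∀ x, holds₂ (M := M) .c0 x s ↔ (M.cfgAt w t).tape (e x) = false := by
    intro t
    induction t with
    | zero =>
      intro _ s hs
      have hs' := (hmin s).2 hs
      refine ⟨fun x hx => ?_, fun x => ?_⟩
      · have : x = s := e.injective (Fin.ext (hx.trans hs.symm))
        subst this
        exact h.run.start x hs'
      · rw [htape s w s (h.tape s hs') x (by rw [Fin.le_def, hs]; exact Nat.zero_le _), hs]
        rfl
    | succ t ih =>
      intro ht s hs
      have hk {i : ℕ} (hi : i < k + 1) : (e (e.symm ⟨i, hi⟩) : ℕ) = i := by simp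
      have ht' : t < k + 1 := by omega
      obtain ⟨ihh, iht⟩ := ih (by omega) (e.symm ⟨t, ht'⟩) (hk _)
      have hhead := Machine.head_cfgAt_le (M := M) w t
      have hhead' : (M.cfgAt w t).head < k + 1 := by omega
      have hst := ihh (e.symm ⟨_, hhead'⟩) (hk _)
      have hne : (M.cfgAt w t).state ≠ M.halt := by
        intro hc
        rw [hc] at hst
        have := (hmax _).1 (h.run.halt _ _ hst)
        rw [hk] at this
        omega
      obtain ⟨h₁, h₂, h₃⟩ := h.run.step _ hne ((M.cfgAt w t).tape (M.cfgAt w t).head)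
        (e.symm ⟨t, ht'⟩) s (e.symm ⟨_, hhead'⟩) ((hsucc _ _).2 (by rw [hk, hs])) hst
        ((hbit _ _ _ _ (iht _)).2 (by rw [hk]))
      rw [Machine.cfgAt_succ, Machine.step, if_neg hne]
      refine ⟨fun x hx => h₃ x ?_, fun x => ?_⟩
      · dsimp only at hx
        rw [toNat_add_sign] at hx
        revert hx
        rcases (M.instr (M.cfgAt w t).state
          ((M.cfgAt w t).tape (M.cfgAt w t).head)).2.2 with _ | _ | _
        · intro hx
          exact e.injective (Fin.ext (by rw [hk, hx]))
        · simp only [moves, hsucc, hmin, hk]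
          intro hx
          by_cases h0 : (M.cfgAt w t).head = 0
          · refine Or.inr ⟨h0, e.injective (Fin.ext ?_)⟩
            rw [hk, hx]
            omega
          · left
            omega
        · simp only [moves, hsucc, hk]
          exact id
      · dsimp only
        by_cases hx : (e x : ℕ) = (M.cfgAt w t).head
        · have : x = e.symm ⟨_, hhead'⟩ := e.injective (Fin.ext (by rw [hk, hx]))
          rw [hx, Function.update_self, this]
          revert h₁
          cases (M.instr (M.cfgAt w t).state
            ((M.cfgAt w t).tape (M.cfgAt w t).head)).2.1 <;> simp [bitIs]
        · rw [Function.update_of_ne hx, ← iht]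
          refine (h₂ x).resolve_left ?_
          rintro rfl
          exact hx (hk _)
  refine ⟨k, ⟨?_, ?_⟩, by rw [Nat.card_congr e, Nat.card_fin]⟩
  · have hhead := Machine.head_cfgAt_le (M := M) w k
    have hst := (main k le_rfl (e.symm (Fin.last k)) (by simp)).1
      (e.symm ⟨(M.cfgAt w k).head, by omega⟩) (by simp)
    by_contra hne
    exact h.run.not_halt _ hne _ _ hst ((hmax _).2 (by simp))
  · intro t ht hc
    have hhead := Machine.head_cfgAt_le (M := M) w t
    have hst := (main t ht.le (e.symm ⟨t, by omega⟩) (by simp)).1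
      (e.symm ⟨(M.cfgAt w t).head, by omega⟩) (by simp)
    rw [hc] at hst
    have := (hmax _).1 (h.run.halt _ _ hst)
    simp at this
    omega

/-- The structure on `{0, …, h}` that describes the first `h` steps of `M` on `w`. -/
@[reducible]
def runStructure (M : Machine) (w : List Bool) (h : ℕ) : M.voc.Structure (Fin (h + 1)) where
  funMap := fun f => isEmptyElim f
  RelMap := fun {_} R => match R with
    | MachineRel.lt => fun x => x 0 < x 1
    | MachineRel.umin => fun x => (x 0 : ℕ) = 0
    | MachineRel.umax => fun x => (x 0 : ℕ) = h
    | MachineRel.succ => fun x => (x 1 : ℕ) = x 0 + 1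
    | MachineRel.h q => fun x => (M.cfgAt w (x 1)).state = q ∧ (M.cfgAt w (x 1)).head = x 0
    | MachineRel.hComp q => fun x =>
        ¬ ((M.cfgAt w (x 1)).state = q ∧ (M.cfgAt w (x 1)).head = x 0)
    | MachineRel.c0 => fun x => (M.cfgAt w (x 1)).tape (x 0) = false
    | MachineRel.c0Comp => fun x => ¬ (M.cfgAt w (x 1)).tape (x 0) = false

theorem isFragment_runStructure (w : List Bool) (h : ℕ) :
    @IsFragment M (Fin (h + 1)) (runStructure M w h) := by
  let _ := runStructure M w h
  have hlt (a b : Fin (h + 1)) : holds₂ (M := M) .lt a b ↔ a < b := Iff.rfl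
  have hmin (a : Fin (h + 1)) : holds₁ (M := M) .umin a ↔ (a : ℕ) = 0 := Iff.rfl
  have hmax (a : Fin (h + 1)) : holds₁ (M := M) .umax a ↔ (a : ℕ) = h := Iff.rfl
  have hsucc (a b : Fin (h + 1)) : holds₂ (M := M) .succ a b ↔ (b : ℕ) = a + 1 := Iff.rfl
  constructor <;> simp only [hlt, hmin, hmax, hsucc] <;> intros <;> omega

theorem isHaltingRun_runStructure {w : List Bool} {h : ℕ} (H : M.HaltsAt w h) :
    @IsHaltingRun M w (Fin (h + 1)) (runStructure M w h) := by
  let _ := runStructure M w h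
  have hlt (a b : Fin (h + 1)) : holds₂ (M := M) .lt a b ↔ a < b := Iff.rfl
  have hmin (a : Fin (h + 1)) : holds₁ (M := M) .umin a ↔ (a : ℕ) = 0 := Iff.rfl
  have hmax (a : Fin (h + 1)) : holds₁ (M := M) .umax a ↔ (a : ℕ) = h := Iff.rfl
  have hsucc (a b : Fin (h + 1)) : holds₂ (M := M) .succ a b ↔ (b : ℕ) = a + 1 := Iff.rfl
  have hh (q : Fin M.numStates) (a b : Fin (h + 1)) : holds₂ (M := M) (.h q) a b ↔
    (M.cfgAt w b).state = q ∧ (M.cfgAt w b).head = a := Iff.rfl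
  have hc (a b : Fin (h + 1)) : holds₂ (M := M) .c0 a b ↔ (M.cfgAt w b).tape a = false := Iff.rfl
  have hbit (b : Bool) (a t : Fin (h + 1)) :
      bitIs (M := M) b a t ↔ (M.cfgAt w t).tape a = b := by
    cases b <;> simp [bitIs, hc]
  refine ⟨⟨⟨0, by simp [hmin]⟩, fun a => ?_⟩, ⟨fun a ha => ?_, fun a t ht => ?_,
    fun q hq a t ht hmx => ?_, fun q hq b t t' a hs hq' hb => ?_⟩, fun a ha => ?_⟩
  · by_cases ha : (a : ℕ) = h
    · exact Or.inl ha
    · exact Or.inr ⟨⟨a + 1, by omega⟩, rfl⟩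
  · rw [hmin] at ha
    rw [hh, ha]
    exact ⟨rfl, rfl⟩
  · rw [hmax]
    rw [hh] at ht
    by_contra hne
    exact H.2 t (by omega) ht.1
  · rw [hmax] at hmx
    rw [hh, hmx] at ht
    exact hq (ht.1.symm.trans H.1)
  · rw [hsucc] at hs
    rw [hh] at hq'
    rw [hbit] at hb
    obtain ⟨rfl, ha⟩ := hq'
    rw [← ha] at hb
    subst hb
    have hcfg : M.cfgAt w t' = _ := (congrArg _ hs).trans (M.cfgAt_succ w t)
    rw [Machine.step, if_neg hq] at hcfg
    refine ⟨?_, fun y => ?_, fun y hy => ?_⟩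
    · rw [hbit, hcfg]
      dsimp only
      rw [ha, Function.update_self]
    · by_cases hy : y = a
      · exact Or.inl hy
      · right
        rw [hc, hc, hcfg]
        dsimp only
        rw [Function.update_of_ne]
        rw [ha]
        exact fun h => hy (Fin.ext h)
    · rw [hh, hcfg]
      refine ⟨rfl, ?_⟩
      dsimp only
      rw [toNat_add_sign]
      revert hy
      rcases (M.instr (M.cfgAt w t).state ((M.cfgAt w t).tape (M.cfgAt w t).head)).2.2
        with _ | _ | _
      · rintro rfl
        simpa using ha
      · rintro (hy | ⟨h0, rfl⟩)
        · rw [hsucc] at hy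
          simp
          omega
        · rw [hmin] at h0
          simp
          omega
      · intro hy
        replace hy := (hsucc _ _).1 hy
        simp
        omega
  · -- `u` is the part of `w` from position `x` on
    have key : ∀ (u : List Bool) (x : Fin (h + 1)),
        (∀ i, u.getD i false = w.getD (x + i) false) → tapeFrom (M := M) a u x := by
      rw [hmin] at ha
      have hcell (x : Fin (h + 1)) : (M.cfgAt w a).tape x = w.getD x false := by rw [ha]; rfl
      intro u
      induction u with
      | nil =>
        intro x hx y
        by_cases hy : y < x
        · exact Or.inl hy
        · right
          have := hx (y - x : ℕ)
          rw [show (x + (y - x : ℕ) : ℕ) = y by omega] at this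
          rw [hc, hcell, ← this]
          rfl
      | cons b u ih =>
        intro x hx
        refine ⟨?_, fun y hy => ih y fun i => ?_⟩
        · rw [hbit, hcell]
          simpa using (hx 0).symm
        · rw [hsucc] at hy
          have := hx (i + 1)
          rw [List.getD_cons_succ] at this
          rw [this, hy]
          congr 1
          omega
    refine key w a fun i => ?_
    rw [hmin] at ha
    rw [ha, zero_add]

/-! ### Universal sentences equivalent to the halting sentence -/

/-- The halting sentence is always finitely equivalent to a universal one: it is preserved under
substructures by `surjective_of_isComplete`, and all complete halting runs have the same size. -/
theorem exists_isUniv_finEquiv_haltingSentence (M : Machine) (w : List Bool) :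
    ∃ μ : M.voc.Sentence, IsUniv μ ∧ FinEquiv (haltingSentence M w) μ := by
  obtain ⟨k, hk⟩ : ∃ k, ∀ k', M.HaltsAt w k' → k' = k := by
    by_cases h : ∃ k, M.HaltsAt w k
    · obtain ⟨k, hk⟩ := h
      exact ⟨k, fun k' hk' => hk'.eq hk⟩
    · exact ⟨0, fun k' hk' => (h ⟨k', hk'⟩).elim⟩
  refine exists_isUniv_finEquiv _ (k + 2) ?_ ?_
  · intro A B _ _ _ _ ι h
    have h' := h
    rw [realize_haltingSentence] at h ⊢
    refine ⟨h.1.of_embedding ι, fun hB => ?_⟩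
    have hs := surjective_of_isComplete ι h.1 hB.complete
    rw [← realize_sentence_of_surjective ι hs, realize_haltingSentence] at h'
    exact h'.2 hB
  · intro A _ _ _ h
    by_contra! hx
    have hfrag : IsFragment M A := by
      refine isFragment_of_triples fun a b c => ?_
      let x : Fin (k + 2 + 1) → A := Fin.cons a (Fin.cons b fun _ => c)
      have := (realize_haltingSentence _ _).1 (hx x)
      refine ⟨Set.range x, ⟨0, rfl⟩, ⟨1, rfl⟩, ⟨Fin.succ (Fin.succ 0), rfl⟩, this.1⟩
    rw [realize_haltingSentence, not_and, not_not] at h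
    obtain ⟨k', hk', hcard⟩ := (h hfrag).exists_haltsAt hfrag
    obtain rfl := hk k' hk'
    have : Fintype A := Fintype.ofFinite A
    obtain ⟨f⟩ : Nonempty (A ↪ Fin (k' + 2 + 1)) :=
      Function.Embedding.nonempty_of_card_le (by
        rw [← Nat.card_eq_fintype_card, hcard, Fintype.card_fin]
        omega)
    have hsurj := Function.invFun_surjective f.injective
    have hx' := hx (Function.invFun f)
    rw [realize_sentence_of_surjective
      (subsetStructure (L := M.voc) (Set.range (Function.invFun f))).subtype
      (fun a => ⟨⟨a, hsurj a⟩, rfl⟩), realize_haltingSentence] at hx'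
    exact hx'.2 (h hfrag)

/-- The halting time is at most the Gödel number of any universal sentence finitely equivalent to
the halting sentence: the complete halting run falsifies this sentence, while all its proper
substructures satisfy it. -/
theorem halts_of_isUniv_finEquiv {w : List Bool} (hw : M.HaltsOn w) {μ : M.voc.Sentence}
    (hμ : IsUniv μ) (h : FinEquiv (haltingSentence M w) μ) :
    (M.cfgAt w (godel μ)).state = M.halt := by
  classical
  obtain ⟨k, hk⟩ : ∃ k, M.HaltsAt w k :=
    ⟨Nat.find hw, Nat.find_spec hw, fun t ht => Nat.find_min hw ht⟩
  refine Machine.state_cfgAt_of_le ?_ hk.1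
  by_contra! hlt
  let _ := runStructure M w k
  have hfrag : IsFragment M (Fin (k + 1)) := isFragment_runStructure w k
  have hnot : ¬ Fin (k + 1) ⊨ μ := by
    rw [← h (Fin (k + 1)), realize_haltingSentence]
    exact fun h' => h'.2 (isHaltingRun_runStructure hk)
  obtain ⟨s, hs, H⟩ := exists_small_witness hμ _ hnot
  obtain ⟨a, ha⟩ : ∃ a, a ∉ s := by
    by_contra! hall
    rw [Finset.eq_univ_of_forall hall, Finset.card_univ, Fintype.card_fin] at hs
    omega
  -- removing an element outside `s` keeps the sentence false, so the rest is still a halting run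
  let B := subsetStructure (L := M.voc) ({a}ᶜ : Set (Fin (k + 1)))
  have hBne : Nonempty B := by
    have : Nontrivial (Fin (k + 1)) := Fin.nontrivial_iff_two_le.2 (by omega)
    obtain ⟨b, hb⟩ := exists_ne a
    exact ⟨⟨b, hb⟩⟩
  have hBnot : ¬ B ⊨ μ := H B B.subtype _ (Subsingleton.elim _ _) fun b hb =>
    ⟨⟨b, fun hba => ha (hba ▸ hb)⟩, rfl⟩
  rw [← h B, realize_haltingSentence, not_and, not_not] at hBnot
  have hB := hBnot (hfrag.of_embedding B.subtype)
  obtain ⟨b, hb⟩ := surjective_of_isComplete B.subtype hfrag hB.complete a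
  exact b.2 hb

end Runs

section Computability

variable {M : Machine}

/-! ### Computing the halting sentence -/

/-- Gödel number of a binary atomic formula, from the code of the symbol and the variables. -/
def binaryCode (r i j : ℕ) : ℕ := Nat.pair 2 (Nat.pair r (Encodable.encode [i, j]))

/-- Gödel number of an implication. -/
def impCode (a b : ℕ) : ℕ := Nat.pair 3 (Nat.pair a b)

/-- Gödel number of a negation. -/
def notCode (a : ℕ) : ℕ := impCode a (Nat.pair 0 0)

/-- Gödel number of a conjunction. -/
def andCode (a b : ℕ) : ℕ := notCode (impCode a (notCode b))

/-- Gödel number of `bitFormula`. -/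
def bitCode (b : Bool) (i : ℕ) : ℕ := bif b then notCode (binaryCode 4 i 0) else binaryCode 4 i 0

/-- Gödel number of `tapeFormula M [] n`. -/
def nilCode (n : ℕ) : ℕ :=
  Nat.pair 4 (impCode (notCode (binaryCode 0 (n + 1) n)) (binaryCode 4 (n + 1) 0))

/-- Gödel number of `tapeFormula M (b :: w) n`, from that of `tapeFormula M w (n + 1)`. -/
def consCode (b : Bool) (n g : ℕ) : ℕ :=
  andCode (bitCode b n) (Nat.pair 4 (impCode (binaryCode 3 n (n + 1)) g))

theorem godel_tapeFormula_nil (n : ℕ) : godel (tapeFormula M [] n) = nilCode n := rfl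

theorem godel_tapeFormula_cons (b : Bool) (w : List Bool) (n : ℕ) :
    godel (tapeFormula M (b :: w) n) = consCode b n (godel (tapeFormula M w (n + 1))) := by
  cases b <;> rfl

/-- The recursion for `tapeFormula` raises the variable index; on codes it is run backwards from
the end of the word, with a counter for this index. -/
theorem foldr_consCode (w : List Bool) (n : ℕ) :
    w.foldr (fun b (s : ℕ × ℕ) => (consCode b (s.2 - 1) s.1, s.2 - 1))
      (nilCode (n + w.length), n + w.length) = (godel (tapeFormula M w n), n) := by
  induction w generalizing n with
  | nil => rfl
  | cons b w ih =>
    have h := ih (n + 1)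
    rw [show n + 1 + w.length = n + (b :: w).length by simp; omega] at h
    rw [List.foldr_cons, h, godel_tapeFormula_cons]
    rfl

theorem primrec_binaryCode {α : Type} [Primcodable α] (r : ℕ) {f g : α → ℕ} (hf : Primrec f)
    (hg : Primrec g) : Primrec fun a => binaryCode r (f a) (g a) :=
  Primrec₂.natPair.comp (.const _) (Primrec₂.natPair.comp (.const _) (Primrec.encode.comp
    (Primrec.list_cons.comp hf (Primrec.list_cons.comp hg (.const [])))))

theorem primrec_impCode : Primrec₂ impCode :=
  Primrec₂.natPair.comp (.const _) (Primrec₂.natPair.comp .fst .snd)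

theorem primrec_notCode : Primrec notCode := primrec_impCode.comp .id (.const _)

theorem primrec_andCode : Primrec₂ andCode :=
  primrec_notCode.comp (primrec_impCode.comp .fst (primrec_notCode.comp .snd))

theorem primrec_nilCode : Primrec nilCode :=
  Primrec₂.natPair.comp (.const _) (primrec_impCode.comp
    (primrec_notCode.comp (primrec_binaryCode 0 .succ .id))
    (primrec_binaryCode 4 .succ (.const _)))

theorem primrec_consCode {α : Type} [Primcodable α] {b : α → Bool} {n g : α → ℕ}
    (hb : Primrec b) (hn : Primrec n) (hg : Primrec g) :
    Primrec fun a => consCode (b a) (n a) (g a) := by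
  have hbit : Primrec fun a => binaryCode 4 (n a) 0 := primrec_binaryCode 4 hn (.const _)
  exact primrec_andCode.comp (.cond hb (primrec_notCode.comp hbit) hbit)
    (Primrec₂.natPair.comp (.const _) (primrec_impCode.comp
      (primrec_binaryCode 3 hn (Primrec.succ.comp hn)) hg))

theorem primrec_godel_tapeFormula (M : Machine) :
    Primrec fun w : List Bool => godel (tapeFormula M w 0) := by
  have hstep : Primrec₂ fun (_ : List Bool) (p : Bool × ℕ × ℕ) =>
      (consCode p.1 (p.2.2 - 1) p.2.1, p.2.2 - 1) := by
    have hn : Primrec fun q : List Bool × Bool × ℕ × ℕ => q.2.2.2 - 1 :=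
      Primrec.pred.comp (Primrec.snd.comp (Primrec.snd.comp .snd))
    exact (primrec_consCode (Primrec.fst.comp .snd) hn
      (Primrec.fst.comp (Primrec.snd.comp .snd))).pair hn
  refine (Primrec.fst.comp (Primrec.list_foldr .id
    ((primrec_nilCode.comp .list_length).pair .list_length) hstep)).of_eq fun w => ?_
  have := foldr_consCode (M := M) w 0
  rw [Nat.zero_add] at this
  exact congrArg Prod.fst this

theorem primrec_godel_haltingSentence (M : Machine) :
    Primrec fun w : List Bool => godel (haltingSentence M w) := by
  have h : ∀ w, godel (haltingSentence M w) =
      andCode (godel (fragmentSentence M)) (notCode (andCode (godel (completeSentence M))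
        (andCode (godel (runSentence M)) (Nat.pair 4 (impCode
          (godel (unary (M := M) .umin (0 : Fin 1))) (godel (tapeFormula M w 0))))))) :=
    fun _ => rfl
  refine Primrec.of_eq ?_ fun w => (h w).symm
  exact primrec_andCode.comp (.const _) (primrec_notCode.comp (primrec_andCode.comp (.const _)
    (primrec_andCode.comp (.const _) (Primrec₂.natPair.comp (.const _)
      (primrec_impCode.comp (.const _) (primrec_godel_tapeFormula M))))))

/-! ### Simulating finitely many steps -/

/-- A step of `M` on configurations given by state, head position and a finite part of the tape
beyond which all cells hold `0`. The move is coded by a summand and a subtrahend. -/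
def listStep (M : Machine) (c : Fin M.numStates × ℕ × List Bool) :
    Fin M.numStates × ℕ × List Bool :=
  if c.1 = M.halt then c
  else
    let r := M.instr c.1 (c.2.2.getD c.2.1 false)
    (r.1, c.2.1 + (if r.2.2 = .pos then 1 else 0) - (if r.2.2 = .neg then 1 else 0),
      (List.range (c.2.2.length + c.2.1 + 1)).map fun i =>
        if i = c.2.1 then r.2.1 else c.2.2.getD i false)

theorem primrec_listStep (M : Machine) : Primrec (listStep M) := by
  have hhead : Primrec fun c : Fin M.numStates × ℕ × List Bool => c.2.1 := Primrec.fst.comp .snd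
  have htape : Primrec fun c : Fin M.numStates × ℕ × List Bool => c.2.2 := Primrec.snd.comp .snd
  have hread : Primrec fun c : Fin M.numStates × ℕ × List Bool =>
      (c.1, c.2.2.getD c.2.1 false) :=
    Primrec.fst.pair ((Primrec.list_getD false).comp htape hhead)
  -- functions of state and scanned symbol have a finite domain
  have hinstr {σ : Type} [Primcodable σ] (f : Fin M.numStates × Bool × SignType → σ) :
      Primrec fun c : Fin M.numStates × ℕ × List Bool =>
        f (M.instr c.1 (c.2.2.getD c.2.1 false)) :=
    (Primrec.dom_finite fun p : Fin M.numStates × Bool => f (M.instr p.1 p.2)).comp hread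
  refine Primrec.ite (Primrec.eq.comp .fst (.const _)) .id ?_
  refine (hinstr fun r => r.1).pair (Primrec.pair ?_ ?_)
  · exact Primrec.nat_sub.comp
      (Primrec.nat_add.comp hhead (hinstr fun r => if r.2.2 = .pos then 1 else 0))
      (hinstr fun r => if r.2.2 = .neg then 1 else 0)
  · refine Primrec.list_map (Primrec.list_range.comp (Primrec.succ.comp
      (Primrec.nat_add.comp (Primrec.list_length.comp htape) hhead))) ?_
    exact Primrec.ite (Primrec.eq.comp .snd (hhead.comp .fst))
      ((hinstr fun r => r.2.1).comp .fst)
      ((Primrec.list_getD false).comp (htape.comp .fst) .snd)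

/-- The configuration that a finite description stands for. -/
def toCfg (c : Fin M.numStates × ℕ × List Bool) : M.Cfg :=
  ⟨c.1, c.2.1, fun i => c.2.2.getD i false⟩

theorem toCfg_listStep (c : Fin M.numStates × ℕ × List Bool) :
    toCfg (listStep M c) = M.step (toCfg c) := by
  obtain ⟨q, k, l⟩ := c
  by_cases hq : q = M.halt
  · simp [listStep, Machine.step, toCfg, hq]
  · rw [listStep, Machine.step, if_neg hq, if_neg (show (toCfg (q, k, l)).state ≠ M.halt from hq)]
    simp only [toCfg, Machine.Cfg.mk.injEq, true_and]
    constructor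
    · rw [toNat_add_sign]
      rcases (M.instr q (l.getD k false)).2.2 with _ | _ | _ <;> simp
    · funext i
      by_cases hi : i = k
      · subst hi
        rw [Function.update_self, List.getD_eq_getElem?_getD, List.getElem?_map,
          List.getElem?_range (by omega)]
        simp
      · rw [Function.update_of_ne hi, List.getD_eq_getElem?_getD, List.getElem?_map]
        by_cases hl : i < l.length + k + 1
        · rw [List.getElem?_range hl]
          simp [hi]
        · have hd : l.getD i false = false := List.getD_eq_default _ _ (by omega)
          rw [List.getElem?_eq_none (by simp; omega), hd]
          rfl

theorem toCfg_iterate_listStep (w : List Bool) (k : ℕ) :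
    toCfg ((listStep M)^[k] (M.start, 0, w)) = M.cfgAt w k := by
  induction k with
  | zero => rfl
  | succ k ih => rw [Function.iterate_succ_apply', toCfg_listStep, ih, Machine.cfgAt_succ]

theorem primrec_state_cfgAt (M : Machine) :
    Primrec₂ fun (w : List Bool) (k : ℕ) => (M.cfgAt w k).state := by
  have h : Primrec fun p : List Bool × ℕ => ((listStep M)^[p.2] (M.start, 0, p.1)).1 :=
    Primrec.fst.comp (Primrec.nat_iterate .snd
      (Primrec.pair (.const _) (Primrec.pair (.const _) .fst))
      ((primrec_listStep M).comp .snd))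
  refine h.of_eq fun p => ?_
  exact congrArg Machine.Cfg.state (toCfg_iterate_listStep p.1 p.2)

end Computability

end FinUniv

theorem mainTheorem10 (M : FinUniv.Machine) (hM : M.IsUniversal) :
    ¬ ∃ f : ℕ →. ℕ, Nat.Partrec f ∧ FinUniv.ComputesUniv M f := by
  rintro ⟨f, hf, hcomp⟩
  obtain ⟨word, hword, hhalts⟩ := hM
  have hW : Computable fun c : Nat.Partrec.Code => word c 0 := hword.comp .id (.const 0)
  choose μ hμ hequiv hmem using fun c : Nat.Partrec.Code =>
    hcomp _ (FinUniv.exists_isUniv_finEquiv_haltingSentence M (word c 0))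
  have hbound : Computable fun c => FinUniv.godel (μ c) :=
    Partrec.of_eq_tot (Partrec.comp (Partrec.nat_iff.2 hf)
      ((FinUniv.primrec_godel_haltingSentence M).to_comp.comp hW)) hmem
  refine ComputablePred.halting_problem 0 ⟨Classical.decPred _, ?_⟩
  have hdec : Computable fun c =>
      decide ((M.cfgAt (word c 0) (FinUniv.godel (μ c))).state = M.halt) :=
    (Primrec.eq.decide.comp .id (.const M.halt)).to_comp.comp
      ((FinUniv.primrec_state_cfgAt M).to_comp.comp hW hbound)
  refine hdec.of_eq fun c => decide_eq_decide.2 ?_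
  refine Iff.trans ?_ (hhalts c 0)
  exact ⟨fun h => ⟨_, h⟩, fun h => FinUniv.halts_of_isUniv_finEquiv h (hμ c) (hequiv c)⟩
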